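/- Let $\alpha_1,\alpha_2\in(0,1)$ and $\lambda,\mu>0$. For $\alpha\in(0,1)$ and $\nu>0$, the Mittag-Leffler law with tail index $\alpha$ and scaling $\nu$ is the law on $[0,\infty)$ with cumulative distribution function $$F_{\alpha,\nu}(x)=1-E_{\alpha,1}(-\nu^\alpha x^\alpha),\quad x\ge 0,\qquad E_{\alpha,1}(z)=\sum_{\ell=0}^\infty \frac{z^\ell}{\Gamma(1+\alpha \ell)}.$$ On a probability space, let $(X_i)_{i\ge1}$ be i.i.d. with the Mittag-Leffler law with tail index $\alpha_1$ and scaling $\lambda$ (inter-arrival times), and let $(Y_i)_{i\ge1}$ be i.i.d. with the Mittag-Leffler law with tail index $\alpha_2$ and scaling $\mu$ (service times), the two sequences being independent of each other. Let $$N^{(\alpha_1)}_\lambda(t)=\max\Big\{k\ge0:\sum_{i=1}^kX_i\le t\Big\},\qquad N^{(\alpha_2)}_\mu(t)=\max\Big\{k\ge0:\sum_{i=1}^kY_i\le t\Big\},\qquad t\ge 0,$$ be the corresponding renewal counting processes, and define the length of the Mittag-Leffler GI/GI/1 queue by $$L(t)=\big(N^{(\alpha_1)}_\lambda(t)-N^{(\alpha_2)}_\mu(t)\big)-\inf_{0\le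 s\le t}\big(N^{(\alpha_1)}_\lambda(s)-N^{(\alpha_2)}_\mu(s)\big),\qquad t\ge0.$$ 1. If $\alpha_1<\alpha_2$, then almost surely $L(t)=0$ infinitely often, that is, the set $\{t\ge0: L(t)=0\}$ is unbounded. 2. If $\alpha_1>\alpha_2$, then almost surely $\limsup_{t\to\infty}L(t)=\infty$. -/

import Mathlib

open MeasureTheory ProbabilityTheory Filter Set

noncomputable section

namespace MLQueue

/-- The two-parameter Mittag-Leffler function `E_{α,β}(z) = ∑ z^ℓ / Γ(β + α ℓ)`, for real `z`. -/
def mittagLeffler (α β z : ℝ) : ℝ :=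
  ∑' l : ℕ, z ^ l / Real.Gamma (β + α * l)

/-- The cumulative distribution function of the Mittag-Leffler law with tail index `α` and
scaling `ν`: it is `1 - E_{α,1}(-ν^α x^α)` for `x ≥ 0` and vanishes on the negative axis. -/
def mittagLefflerCDF (α ν x : ℝ) : ℝ :=
  if x < 0 then 0 else 1 - mittagLeffler α 1 (-(ν ^ α * x ^ α))

/-- `T 0, T 1, …` are independent random variables, each of which has the Mittag-Leffler law with
tail index `α` and scaling `ν`. -/
structure IsMittagLefflerSequence {Ω : Type*} [MeasurableSpace Ω] (P : Measure Ω)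
    (α ν : ℝ) (T : ℕ → Ω → ℝ) : Prop where
  measurable : ∀ i, Measurable (T i)
  indep : iIndepFun T P
  law : ∀ i x, P.real {ω | T i ω ≤ x} = mittagLefflerCDF α ν x

/-- The renewal counting process with inter-event times `T 0, T 1, …`, along one sample path:
the largest `k` for which the `k`-th event time `T 0 + … + T (k - 1)` is at most `t`. -/
def count (T : ℕ → ℝ) (t : ℝ) : ℕ :=
  sSup {k : ℕ | ∑ i ∈ Finset.range k, T i ≤ t}

/-- Arrivals minus departure attempts up to time `t`, along one sample path. -/
def netInput (X Y : ℕ → ℝ) (t : ℝ) : ℤ :=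
  (count X t : ℤ) - (count Y t : ℤ)

/-- The queue length at time `t ≥ 0`, along one sample path with inter-arrival times `X` and
service times `Y`: the net input reflected at its running infimum over `[0, t]`. -/
def queueLength (X Y : ℕ → ℝ) (t : ℝ) : ℤ :=
  netInput X Y t - sInf (netInput X Y '' Icc 0 t)

end MLQueue

end

namespace MLQueue

open scoped Topology

/-! ### Sample paths -/

/-! The Laplace transform `ν ^ α / (ν ^ α + s ^ α)` shows that a sum of `k` variables of tail index
`α` lives on the scale `k ^ (1 / α)`: at `s = 1 / t`, Chernoff and Markov bounds make `S_k ≤ t`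
unlikely for `k` far above `t ^ α`, and `S_k > t` unlikely for `k` far below it (`prob_sum_le`,
`prob_lt_sum`). For indices `a < β < b`, at time `n ^ (1 / β)` the process of index `a` has
therefore counted at most `n` events, and that of index `b` at least `n + M`, with probability
tending to 1. That this almost surely happens for arbitrarily large `n` needs no rate: failing for
all `n ≥ N` is no likelier than failing at any single such `n` (`ae_exists_count_add_le`). The rest
is pathwise. Late new minima of the net input empty the queue, and the queue length is at least the
net input minus its value at time 0. -/

lemma sum_range_mono {T : ℕ → ℝ} (hT : ∀ i, 0 ≤ T i) :
    Monotone fun k => ∑ i ∈ Finset.range k, T i :=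
  monotone_nat_of_le_succ fun k => by
    rw [Finset.sum_range_succ]
    linarith [hT k]

lemma bddAbove_count_set {T : ℕ → ℝ} (hT : ∀ i, 0 ≤ T i)
    (hT' : ∀ t, ∃ k, t < ∑ i ∈ Finset.range k, T i) (t : ℝ) :
    BddAbove {k : ℕ | ∑ i ∈ Finset.range k, T i ≤ t} := by
  obtain ⟨n, hn⟩ := hT' t
  refine ⟨n, fun k hk => ?_⟩
  by_contra! h
  exact absurd (hn.trans_le (sum_range_mono hT h.le)) (not_lt.2 hk)

lemma le_count {T : ℕ → ℝ} (hT : ∀ i, 0 ≤ T i)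
    (hT' : ∀ t, ∃ k, t < ∑ i ∈ Finset.range k, T i) {t : ℝ} {n : ℕ}
    (h : ∑ i ∈ Finset.range n, T i ≤ t) : n ≤ count T t :=
  le_csSup (bddAbove_count_set hT hT' t) h

lemma count_le {T : ℕ → ℝ} (hT : ∀ i, 0 ≤ T i) {t : ℝ} {n : ℕ}
    (h : t < ∑ i ∈ Finset.range (n + 1), T i) : count T t ≤ n := by
  -- In `ℕ` the supremum of the empty set is 0, so negative `t` needs no separate case.
  refine csSup_le' fun k hk => ?_
  by_contra! hlt
  exact absurd (h.trans_le (sum_range_mono hT hlt)) (not_lt.2 hk)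

lemma count_mono {T : ℕ → ℝ} (hT : ∀ i, 0 ≤ T i)
    (hT' : ∀ t, ∃ k, t < ∑ i ∈ Finset.range k, T i) : Monotone (count T) := by
  intro s t hst
  refine csSup_le' fun k hk => le_count hT hT' (le_trans hk hst)

lemma bddBelow_netInput {X Y : ℕ → ℝ} (hY : ∀ i, 0 ≤ Y i)
    (hY' : ∀ t, ∃ k, t < ∑ i ∈ Finset.range k, Y i) (t : ℝ) :
    BddBelow (netInput X Y '' Icc 0 t) := by
  refine ⟨-(count Y t : ℤ), ?_⟩
  rintro _ ⟨s, hs, rfl⟩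
  have := count_mono hY hY' hs.2
  simp only [netInput]
  omega

/-- If the net input is unbounded below, the queue empties at arbitrarily late times. -/
lemma frequently_queueLength_eq_zero {X Y : ℕ → ℝ} (hY : ∀ i, 0 ≤ Y i)
    (hY' : ∀ t, ∃ k, t < ∑ i ∈ Finset.range k, Y i)
    (h : ∀ M : ℕ, ∃ t, 0 ≤ t ∧ count X t + M ≤ count Y t) :
    ∃ᶠ t : ℝ in atTop, queueLength X Y t = 0 := by
  rw [frequently_atTop]
  intro r
  -- On `[0, r]` the net input is at least `-count Y r`. One unit below that forces the minimiser
  -- over `[0, t]` past `r`; it also minimises over `[0, s]`, so the queue is empty there.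
  obtain ⟨t, ht0, ht⟩ := h (count Y r + 1)
  obtain ⟨s, hs, hs'⟩ := Int.csInf_mem (s := netInput X Y '' Icc 0 t)
    ⟨_, 0, ⟨le_rfl, ht0⟩, rfl⟩ (bddBelow_netInput hY hY' t)
  have hle : ∀ u ∈ Icc 0 t, netInput X Y s ≤ netInput X Y u := fun u hu => by
    rw [hs']
    exact csInf_le (bddBelow_netInput hY hY' t) ⟨u, hu, rfl⟩
  refine ⟨s, ?_, ?_⟩
  · by_contra! hsr
    have h1 := count_mono hY hY' hsr.le
    have h2 := hle t ⟨ht0, le_rfl⟩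
    simp only [netInput] at h2
    omega
  · have : IsLeast (netInput X Y '' Icc 0 s) (netInput X Y s) :=
      ⟨⟨s, ⟨hs.1, le_rfl⟩, rfl⟩, by
        rintro _ ⟨u, hu, rfl⟩
        exact hle u ⟨hu.1, hu.2.trans hs.2⟩⟩
    rw [queueLength, this.csInf_eq, sub_self]

/-- If the net input is unbounded above at late times, so is the queue length. -/
lemma limsup_queueLength_eq_top {X Y : ℕ → ℝ} (hY : ∀ i, 0 ≤ Y i)
    (hY' : ∀ t, ∃ k, t < ∑ i ∈ Finset.range k, Y i)
    (h : ∀ (M : ℕ) (r : ℝ), ∃ t, r ≤ t ∧ count Y t + M ≤ count X t) :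
    limsup (fun t : ℝ => ((queueLength X Y t : ℝ) : EReal)) atTop = ⊤ := by
  rw [EReal.eq_top_iff_forall_lt]
  intro y
  obtain ⟨m, hm⟩ := exists_nat_gt y
  refine lt_of_lt_of_le (EReal.coe_lt_coe_iff.2 hm) (le_limsup_of_frequently_le ?_)
  rw [frequently_atTop]
  intro r
  -- The extra `count X 0` absorbs the net input at time 0, which bounds the infimum from above.
  obtain ⟨t, ht, hM⟩ := h (m + count X 0) (max r 0)
  refine ⟨t, (le_max_left _ _).trans ht, ?_⟩
  have h1 : sInf (netInput X Y '' Icc 0 t) ≤ netInput X Y 0 :=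
    csInf_le (bddBelow_netInput hY hY' t) ⟨0, ⟨le_rfl, (le_max_right _ _).trans ht⟩, rfl⟩
  have h2 : (m : ℤ) ≤ queueLength X Y t := by
    simp only [queueLength, netInput] at h1 ⊢
    omega
  exact EReal.coe_le_coe_iff.2 (by exact_mod_cast h2)

/-! ### The Laplace transform of the Mittag-Leffler law -/

/-- Termwise integration of the Mittag-Leffler series against `s * exp (-s t)`. -/
lemma integral_mittagLeffler_mul_exp {α ν s : ℝ} (hα : 0 < α) (hν : 0 < ν) (hs : ν < s) :
    ∫ t in Ioi (0 : ℝ), mittagLeffler α 1 (-(ν ^ α * t ^ α)) * (s * Real.exp (-(s * t))) =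
      s ^ α / (ν ^ α + s ^ α) := by
  have hs0 : 0 < s := hν.trans hs
  have hνα : 0 < ν ^ α := Real.rpow_pos_of_pos hν α
  have hsα : 0 < s ^ α := Real.rpow_pos_of_pos hs0 α
  -- After integration the series is geometric with ratio `-r`; `ν < s` gives `r < 1`, hence the
  -- absolute convergence that justifies the interchange.
  set r : ℝ := ν ^ α / s ^ α with hr
  have hr0 : 0 < r := by positivity
  have hr1 : r < 1 := (div_lt_one hsα).2 (Real.rpow_lt_rpow hν.le hs hα)
  let c : ℕ → ℝ := fun l => s / Real.Gamma (1 + α * l)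
  have hΓ : ∀ l : ℕ, 0 < Real.Gamma (1 + α * l) := fun l => Real.Gamma_pos_of_pos (by positivity)
  let F : ℕ → ℝ → ℝ := fun l t =>
    (-ν ^ α) ^ l * c l * (t ^ ((1 + α * l) - 1) * Real.exp (-(s * t)))
  have hval : ∀ l : ℕ, c l * ((1 / s) ^ (1 + α * l) * Real.Gamma (1 + α * l)) =
      ((s ^ α)⁻¹) ^ l := by
    intro l
    have h1 : (1 / s) ^ (1 + α * l) = s⁻¹ * ((s ^ α)⁻¹) ^ l := by
      rw [one_div, Real.rpow_add (by positivity), Real.rpow_one, Real.rpow_mul (by positivity),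
        Real.rpow_natCast, Real.inv_rpow hs0.le]
    rw [h1]
    simp only [c]
    field_simp [(hΓ l).ne']
  have hint : ∀ l : ℕ, ∫ t in Ioi (0 : ℝ), t ^ ((1 + α * l) - 1) * Real.exp (-(s * t)) =
      (1 / s) ^ (1 + α * l) * Real.Gamma (1 + α * l) :=
    fun l => Real.integral_rpow_mul_exp_neg_mul_Ioi (by positivity) hs0
  have hFint : ∀ l, Integrable (F l) (volume.restrict (Ioi 0)) := by
    intro l
    -- A non-integrable function has integral 0 by convention, so a positive integral proves
    -- integrability.
    refine Integrable.const_mul (Integrable.of_integral_ne_zero ?_) _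
    rw [hint l]
    have := hΓ l
    positivity
  have hFval : ∀ l, ∫ t in Ioi (0 : ℝ), F l t = (-r) ^ l := by
    intro l
    simp only [F]
    rw [integral_const_mul, hint l, mul_assoc, hval, ← mul_pow, hr, div_eq_mul_inv, neg_mul]
  have hFnorm : ∀ l, ∫ t in Ioi (0 : ℝ), ‖F l t‖ = r ^ l := by
    intro l
    have hc : 0 < c l := div_pos hs0 (hΓ l)
    have : ∀ t ∈ Ioi (0 : ℝ), ‖F l t‖ =
        (ν ^ α) ^ l * c l * (t ^ ((1 + α * l) - 1) * Real.exp (-(s * t))) := by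
      intro t ht
      have ht' : 0 ≤ t ^ ((1 + α * l) - 1) := Real.rpow_nonneg (le_of_lt ht) _
      simp only [F, norm_mul, norm_pow, norm_neg, Real.norm_eq_abs, abs_of_pos hνα,
        abs_of_pos hc, Real.abs_exp, abs_of_nonneg ht']
    rw [setIntegral_congr_fun measurableSet_Ioi this, integral_const_mul, hint l, mul_assoc, hval,
      ← mul_pow, hr, div_eq_mul_inv]
  have hsum := hasSum_integral_of_summable_integral_norm hFint
    (by simp only [hFnorm]; exact summable_geometric_of_lt_one hr0.le hr1)
  simp only [hFval] at hsum
  have hgeo : HasSum (fun l : ℕ => (-r) ^ l) (1 - -r)⁻¹ :=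
    hasSum_geometric_of_abs_lt_one (by rwa [abs_neg, abs_of_pos hr0])
  have hEq := hsum.unique hgeo
  rw [show s ^ α / (ν ^ α + s ^ α) = (1 - -r)⁻¹ by
    rw [hr, sub_neg_eq_add, one_add_div hsα.ne', inv_div, add_comm], ← hEq]
  refine setIntegral_congr_fun measurableSet_Ioi fun t ht => ?_
  simp only [mittagLeffler]
  rw [← tsum_mul_right]
  refine tsum_congr fun l => ?_
  simp only [F, c]
  rw [add_sub_cancel_left, Real.rpow_mul (le_of_lt ht), Real.rpow_natCast, ← neg_mul, mul_pow]
  ring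

lemma mittagLefflerCDF_zero {α ν : ℝ} (hα : 0 < α) : mittagLefflerCDF α ν 0 = 0 := by
  simp only [mittagLefflerCDF, lt_irrefl, if_false, mittagLeffler, Real.zero_rpow hα.ne', mul_zero,
    neg_zero]
  rw [tsum_eq_single 0 (fun l hl => by rw [zero_pow hl, zero_div])]
  simp

section Law

variable {Ω : Type*} [MeasurableSpace Ω] {P : Measure Ω} [IsProbabilityMeasure P] {α ν : ℝ}

lemma ae_pos_of_law {T : Ω → ℝ} (hα : 0 < α)
    (hlaw : ∀ x, P.real {ω | T ω ≤ x} = mittagLefflerCDF α ν x) : ∀ᵐ ω ∂P, 0 < T ω := by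
  have h := hlaw 0
  rw [mittagLefflerCDF_zero hα, measureReal_eq_zero_iff] at h
  rw [ae_iff]
  simpa using h

lemma integrable_exp_neg_mul {T : Ω → ℝ} (hm : Measurable T) (h0 : ∀ᵐ ω ∂P, 0 ≤ T ω) {s : ℝ}
    (hs : s ≤ 0) : Integrable (fun ω => Real.exp (s * T ω)) P := by
  refine Integrable.of_bound (by fun_prop) 1 ?_
  filter_upwards [h0] with ω hω
  rw [Real.norm_eq_abs, Real.abs_exp, Real.exp_le_one_iff]
  exact mul_nonpos_of_nonpos_of_nonneg hs hω

/-- Layer cake: `1 - exp (-s T)` is the integral of `s * exp (-s t)` over `[0, T]`, so its mean is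
the integral of that density against the tail `P (T > t)`, a Mittag-Leffler function. -/
lemma mgf_of_law_of_lt {T : Ω → ℝ} (hα : 0 < α) (hν : 0 < ν) (hm : Measurable T)
    (hlaw : ∀ x, P.real {ω | T ω ≤ x} = mittagLefflerCDF α ν x) {s : ℝ} (hs : ν < s) :
    mgf T P (-s) = ν ^ α / (ν ^ α + s ^ α) := by
  have hs0 : 0 < s := hν.trans hs
  have hpos := ae_pos_of_law hα hlaw
  have h0 : ∀ᵐ ω ∂P, 0 ≤ T ω := hpos.mono fun _ h => h.le
  have hint := integrable_exp_neg_mul hm h0 (neg_nonpos.2 hs0.le)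
  let g : ℝ → ℝ := fun t => s * Real.exp (-(s * t))
  have hg : Continuous g := by fun_prop
  have hgint : ∀ x, ∫ t in (0 : ℝ)..x, g t = 1 - Real.exp (-s * x) := by
    intro x
    rw [intervalIntegral.integral_eq_sub_of_hasDerivAt (f := fun t => -Real.exp (-(s * t)))
      (fun t _ => ?_) (hg.intervalIntegrable _ _)]
    · simp; ring
    · have h1 : HasDerivAt (fun t : ℝ => -(s * t)) (-s) t := by
        simpa using ((hasDerivAt_id t).const_mul s).fun_neg
      convert h1.exp.fun_neg using 1
      simp only [g]
      ring
  have hlc := lintegral_comp_eq_lintegral_meas_lt_mul (g := g) P h0 hm.aemeasurable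
    (fun t _ => hg.intervalIntegrable _ _) (ae_of_all _ fun t => by positivity)
  simp only [hgint] at hlc
  have hL : ∫ ω, (1 - Real.exp (-s * T ω)) ∂P =
      (∫⁻ ω, ENNReal.ofReal (1 - Real.exp (-s * T ω)) ∂P).toReal := by
    refine integral_eq_lintegral_of_nonneg_ae ?_ (by fun_prop)
    filter_upwards [h0] with ω hω
    simp only [Pi.zero_apply, sub_nonneg, Real.exp_le_one_iff]
    nlinarith
  have hanti : Antitone fun t => P.real {ω | t < T ω} := fun a b hab =>
    measureReal_mono fun ω hω => lt_of_le_of_lt hab hω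
  have hR : ∫ t in Ioi (0 : ℝ), P.real {ω | t < T ω} * g t =
      (∫⁻ t in Ioi (0 : ℝ), P {ω | t < T ω} * ENNReal.ofReal (g t)).toReal := by
    rw [integral_eq_lintegral_of_nonneg_ae (f := fun t => P.real {ω | t < T ω} * g t)
      (ae_of_all _ fun t => mul_nonneg measureReal_nonneg (by positivity))
      (hanti.measurable.mul hg.measurable).aestronglyMeasurable]
    congr 1
    refine lintegral_congr fun t => ?_
    rw [ENNReal.ofReal_mul measureReal_nonneg, ofReal_measureReal]
  have htail : ∀ t ∈ Ioi (0 : ℝ), P.real {ω | t < T ω} * g t =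
      mittagLeffler α 1 (-(ν ^ α * t ^ α)) * (s * Real.exp (-(s * t))) := by
    intro t ht
    have hc : {ω | t < T ω} = {ω | T ω ≤ t}ᶜ := by ext; simp
    rw [hc, probReal_compl_eq_one_sub (measurableSet_le hm measurable_const), hlaw t,
      mittagLefflerCDF, if_neg (not_lt.2 (le_of_lt ht)), sub_sub_cancel]
  rw [hlc, ← hR, setIntegral_congr_fun measurableSet_Ioi htail,
    integral_mittagLeffler_mul_exp hα hν hs, integral_sub (integrable_const _) hint] at hL
  have h1 : ∫ _ : Ω, (1 : ℝ) ∂P = 1 := by simp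
  rw [h1] at hL
  have hνα : 0 < ν ^ α := Real.rpow_pos_of_pos hν α
  have hsα : 0 < s ^ α := Real.rpow_pos_of_pos hs0 α
  have h2 : mgf T P (-s) = 1 - s ^ α / (ν ^ α + s ^ α) := by
    rw [mgf]; linarith
  rw [h2]
  field_simp
  ring

/-- The Laplace transform of the Mittag-Leffler law; the identity extends from large to all
positive arguments by analyticity. -/
lemma mgf_of_law {T : Ω → ℝ} (hα : 0 < α) (hν : 0 < ν) (hm : Measurable T)
    (hlaw : ∀ x, P.real {ω | T ω ≤ x} = mittagLefflerCDF α ν x) {s : ℝ} (hs : 0 < s) :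
    mgf T P (-s) = ν ^ α / (ν ^ α + s ^ α) := by
  have h0 : ∀ᵐ ω ∂P, 0 ≤ T ω := (ae_pos_of_law hα hlaw).mono fun _ h => h.le
  have hνα : 0 < ν ^ α := Real.rpow_pos_of_pos hν α
  have hsub : Iio (0 : ℝ) ⊆ interior (integrableExpSet T P) :=
    interior_maximal (fun x hx => integrable_exp_neg_mul hm h0 (le_of_lt hx)) isOpen_Iio
  have hf : AnalyticOnNhd ℝ (mgf T P) (Iio 0) := analyticOnNhd_mgf.mono hsub
  have hg : AnalyticOnNhd ℝ (fun x : ℝ => ν ^ α / (ν ^ α + (-x) ^ α)) (Iio 0) := by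
    intro x hx
    have hx' : 0 < -x := neg_pos.2 hx
    have hpow : AnalyticAt ℝ (fun y : ℝ => y ^ α) (-x) :=
      (Real.contDiffAt_rpow_const_of_ne hx'.ne').analyticAt
    have hcomp : AnalyticAt ℝ (fun y : ℝ => (-y) ^ α) x :=
      AnalyticAt.fun_comp (g := fun y : ℝ => y ^ α) hpow analyticAt_id.neg
    refine analyticAt_const.div (analyticAt_const.add hcomp) ?_
    have := Real.rpow_pos_of_pos hx' α
    positivity
  have hmem : -(ν + 1) ∈ Iio (0 : ℝ) := by simp only [mem_Iio]; linarith
  have hev : mgf T P =ᶠ[𝓝 (-(ν + 1))] fun x : ℝ => ν ^ α / (ν ^ α + (-x) ^ α) := by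
    filter_upwards [Iio_mem_nhds (show -(ν + 1) < -ν by linarith)] with x hx
    have := mgf_of_law_of_lt hα hν hm hlaw (s := -x) (lt_neg_of_lt_neg hx)
    rwa [neg_neg] at this
  have := hf.eqOn_of_preconnected_of_eventuallyEq hg isPreconnected_Iio hmem hev
    (show -s ∈ Iio (0 : ℝ) from neg_lt_zero.2 hs)
  simpa using this

end Law

/-! ### Partial sums of Mittag-Leffler sequences -/

section Sums

variable {Ω : Type*} [MeasurableSpace Ω] {P : Measure Ω} [IsProbabilityMeasure P] {α ν : ℝ}
  {T : ℕ → Ω → ℝ}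

lemma IsMittagLefflerSequence.ae_pos (h : IsMittagLefflerSequence P α ν T) (hα : 0 < α) :
    ∀ᵐ ω ∂P, ∀ i, 0 < T i ω :=
  ae_all_iff.2 fun i => ae_pos_of_law hα (h.law i)

lemma IsMittagLefflerSequence.ae_sum_nonneg (h : IsMittagLefflerSequence P α ν T) (hα : 0 < α)
    (k : ℕ) : ∀ᵐ ω ∂P, 0 ≤ (∑ i ∈ Finset.range k, T i) ω := by
  filter_upwards [h.ae_pos hα] with ω hω
  rw [Finset.sum_apply]
  exact Finset.sum_nonneg fun i _ => (hω i).le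

lemma IsMittagLefflerSequence.mgf_sum (h : IsMittagLefflerSequence P α ν T) (hα : 0 < α)
    (hν : 0 < ν) (k : ℕ) {t : ℝ} (ht : 0 < t) :
    mgf (∑ i ∈ Finset.range k, T i) P (-t⁻¹) = ((1 + ((ν * t) ^ α)⁻¹)⁻¹) ^ k := by
  have hνα : 0 < ν ^ α := Real.rpow_pos_of_pos hν α
  have htα : 0 < t ^ α := Real.rpow_pos_of_pos ht α
  rw [h.indep.mgf_sum h.measurable, Finset.prod_congr rfl fun i _ =>
    mgf_of_law hα hν (h.measurable i) (h.law i) (inv_pos.2 ht), Finset.prod_const,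
    Finset.card_range, Real.inv_rpow ht.le, Real.mul_rpow hν.le ht.le]
  congr 1
  field_simp

/-- Chernoff bound for the lower tail of the partial sums. -/
lemma IsMittagLefflerSequence.prob_sum_le (h : IsMittagLefflerSequence P α ν T) (hα : 0 < α)
    (hν : 0 < ν) (k : ℕ) {t : ℝ} (ht : 0 < t) :
    P.real {ω | ∑ i ∈ Finset.range k, T i ω ≤ t} ≤ Real.exp 1 * (1 + k * ((ν * t) ^ α)⁻¹)⁻¹ := by
  have hx : 0 < ((ν * t) ^ α)⁻¹ := by positivity
  have hm : Measurable (∑ i ∈ Finset.range k, T i) := by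
    rw [Finset.sum_fn]
    exact Finset.measurable_sum _ fun i _ => h.measurable i
  have hb := measure_le_le_exp_mul_mgf (X := ∑ i ∈ Finset.range k, T i) t
    (neg_nonpos.2 (inv_pos.2 ht).le)
    (integrable_exp_neg_mul hm (h.ae_sum_nonneg hα k) (neg_nonpos.2 (inv_pos.2 ht).le))
  rw [h.mgf_sum hα hν k ht, neg_neg, inv_mul_cancel₀ ht.ne'] at hb
  simp only [Finset.sum_apply] at hb
  refine hb.trans ?_
  rw [inv_pow]
  gcongr
  -- Bernoulli discards most of the decay in `k`; linear decay is enough.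
  exact one_add_mul_le_pow (by linarith) k

/-- Markov bound for the upper tail of the partial sums. -/
lemma IsMittagLefflerSequence.prob_lt_sum (h : IsMittagLefflerSequence P α ν T) (hα : 0 < α)
    (hν : 0 < ν) (k : ℕ) {t : ℝ} (ht : 0 < t) :
    P.real {ω | t < ∑ i ∈ Finset.range k, T i ω} ≤
      (1 - Real.exp (-1))⁻¹ * (k * ((ν * t) ^ α)⁻¹) := by
  set x : ℝ := ((ν * t) ^ α)⁻¹ with hx
  have hx0 : 0 < x := by positivity
  have hm : Measurable (∑ i ∈ Finset.range k, T i) := by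
    rw [Finset.sum_fn]
    exact Finset.measurable_sum _ fun i _ => h.measurable i
  have hs : -t⁻¹ ≤ 0 := neg_nonpos.2 (inv_pos.2 ht).le
  have hint := integrable_exp_neg_mul hm (h.ae_sum_nonneg hα k) hs
  have hc : 0 < 1 - Real.exp (-1) := by
    rw [sub_pos, Real.exp_lt_one_iff]
    norm_num
  -- The sum itself has infinite mean when `0 < α < 1` and `k > 0`, so Markov is applied to the
  -- bounded variable `1 - exp (-S / t)`, which is at least `1 - exp (-1)` once `S > t`.
  have hmarkov := mul_meas_ge_le_integral_of_nonneg (μ := P)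
    (f := fun ω => 1 - Real.exp (-t⁻¹ * (∑ i ∈ Finset.range k, T i) ω))
    (by
      filter_upwards [h.ae_sum_nonneg hα k] with ω hω
      simp only [Pi.zero_apply, sub_nonneg, Real.exp_le_one_iff]
      exact mul_nonpos_of_nonpos_of_nonneg hs hω)
    ((integrable_const _).sub hint) (1 - Real.exp (-1))
  have hval : ∫ ω, (1 - Real.exp (-t⁻¹ * (∑ i ∈ Finset.range k, T i) ω)) ∂P =
      1 - ((1 + x)⁻¹) ^ k := by
    rw [integral_sub (integrable_const _) hint, ← h.mgf_sum hα hν k ht, mgf]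
    simp
  have hbern : 1 - ((1 + x)⁻¹) ^ k ≤ k * x := by
    have hinv : 1 - x ≤ (1 + x)⁻¹ := by
      rw [← one_div, le_div_iff₀ (by positivity)]
      nlinarith [sq_nonneg x]
    have := one_add_mul_le_pow (show -2 ≤ (1 + x)⁻¹ - 1 by
      have : 0 < (1 + x)⁻¹ := by positivity
      linarith) k
    rw [add_sub_cancel] at this
    have hk : (k : ℝ) * (1 - x) ≤ k * (1 + x)⁻¹ := by gcongr
    linarith
  rw [hval] at hmarkov
  have hsub : P.real {ω | t < ∑ i ∈ Finset.range k, T i ω} ≤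
      P.real {ω | 1 - Real.exp (-1) ≤
        1 - Real.exp (-t⁻¹ * (∑ i ∈ Finset.range k, T i) ω)} := by
    refine measureReal_mono fun ω hω => ?_
    simp only [mem_ofPred_eq, Finset.sum_apply] at hω ⊢
    gcongr
    rw [neg_mul, neg_le_neg_iff, ← inv_mul_cancel₀ ht.ne']
    gcongr
  rw [inv_mul_eq_div, le_div_iff₀ hc, mul_comm]
  exact (mul_le_mul_of_nonneg_left hsub hc.le).trans (hmarkov.trans hbern)

/-- If all partial sums stay below a level, each of the events in `prob_sum_le` occurs, and their
probabilities tend to 0 in `k`. This keeps the counting sets bounded. -/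
lemma IsMittagLefflerSequence.ae_exists_lt_sum (h : IsMittagLefflerSequence P α ν T) (hα : 0 < α)
    (hν : 0 < ν) : ∀ᵐ ω ∂P, ∀ t, ∃ k, t < ∑ i ∈ Finset.range k, T i ω := by
  have hnat : ∀ᵐ ω ∂P, ∀ n : ℕ, ∃ k, ((n + 1 : ℕ) : ℝ) < ∑ i ∈ Finset.range k, T i ω := by
    refine ae_all_iff.2 fun n => ?_
    rw [ae_iff, ← measureReal_eq_zero_iff]
    have ht : (0 : ℝ) < ((n + 1 : ℕ) : ℝ) := by positivity
    have hx : 0 < ((ν * ((n + 1 : ℕ) : ℝ)) ^ α)⁻¹ := by positivity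
    have hlim : Tendsto (fun k : ℕ =>
        Real.exp 1 * (1 + k * ((ν * ((n + 1 : ℕ) : ℝ)) ^ α)⁻¹)⁻¹) atTop (𝓝 0) := by
      rw [← mul_zero (Real.exp 1)]
      exact (tendsto_inv_atTop_zero.comp (tendsto_atTop_add_const_left _ _
        (tendsto_natCast_atTop_atTop.atTop_mul_const hx))).const_mul _
    refine le_antisymm (ge_of_tendsto' hlim fun k => ?_) measureReal_nonneg
    refine le_trans (measureReal_mono fun ω hω => ?_) (h.prob_sum_le hα hν k ht)
    simp only [mem_ofPred_eq, not_exists, not_lt] at hω ⊢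
    exact hω k
  filter_upwards [hnat] with ω hω t
  obtain ⟨n, hn⟩ := exists_nat_gt t
  obtain ⟨k, hk⟩ := hω n
  exact ⟨k, by push_cast at hk; linarith⟩

end Sums

/-! ### Comparison of two renewal processes -/

lemma mul_rpow_rpow_one_div {ν α β : ℝ} (hν : 0 < ν) (n : ℕ) :
    (ν * (n : ℝ) ^ (1 / β)) ^ α = ν ^ α * (n : ℝ) ^ (α / β) := by
  rw [Real.mul_rpow hν.le (by positivity), ← Real.rpow_mul (by positivity), one_div_mul_eq_div]

lemma natCast_mul_inv_rpow {γ : ℝ} {n : ℕ} (hn : 0 < n) :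
    (n : ℝ) * ((n : ℝ) ^ γ)⁻¹ = (n : ℝ) ^ (1 - γ) := by
  rw [Real.rpow_sub (by positivity), Real.rpow_one, div_eq_mul_inv]

/-- With `τ = n ^ (1 / β)`, the quantity `n / τ ^ α` is `n ^ (1 - α / β)`; the sign of the exponent
decides the limit, here and in the next lemma. -/
lemma tendsto_add_mul_inv_rpow_zero {ν α β : ℝ} (hν : 0 < ν) (hβ : 0 < β) (h : β < α) (M : ℕ) :
    Tendsto (fun n : ℕ => ((n + M : ℕ) : ℝ) * ((ν * (n : ℝ) ^ (1 / β)) ^ α)⁻¹) atTop (𝓝 0) := by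
  have h1 : 0 < α / β - 1 := by rw [sub_pos, one_lt_div hβ]; exact h
  have hA := (tendsto_rpow_neg_atTop h1).comp (tendsto_natCast_atTop_atTop (R := ℝ))
  have hB := (tendsto_rpow_neg_atTop (div_pos (hβ.trans h) hβ)).comp
    (tendsto_natCast_atTop_atTop (R := ℝ))
  have := (hA.add (hB.const_mul (M : ℝ))).const_mul (ν ^ α)⁻¹
  simp only [mul_zero, add_zero] at this
  refine this.congr' ?_
  filter_upwards [eventually_gt_atTop 0] with n hn
  simp only [Function.comp_apply]
  rw [mul_rpow_rpow_one_div hν, mul_inv, neg_sub, ← natCast_mul_inv_rpow hn,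
    Real.rpow_neg (by positivity)]
  push_cast
  ring

lemma tendsto_succ_mul_inv_rpow_atTop {ν α β : ℝ} (hν : 0 < ν) (hβ : 0 < β) (h : α < β) :
    Tendsto (fun n : ℕ => ((n + 1 : ℕ) : ℝ) * ((ν * (n : ℝ) ^ (1 / β)) ^ α)⁻¹) atTop atTop := by
  have h1 : 0 < 1 - α / β := by rw [sub_pos, div_lt_one hβ]; exact h
  have hA := ((tendsto_rpow_atTop h1).comp (tendsto_natCast_atTop_atTop (R := ℝ))).const_mul_atTop
    (inv_pos.2 (Real.rpow_pos_of_pos hν α))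
  refine tendsto_atTop_mono' _ ?_ hA
  filter_upwards [eventually_gt_atTop 0] with n hn
  simp only [Function.comp_apply]
  rw [mul_rpow_rpow_one_div hν, mul_inv, ← natCast_mul_inv_rpow hn, mul_left_comm]
  gcongr
  simp

/-- The renewal process with the larger tail index is ahead by any amount at arbitrarily late
times. -/
lemma ae_exists_count_add_le {Ω : Type*} [MeasurableSpace Ω] {P : Measure Ω}
    [IsProbabilityMeasure P] {a b ν κ : ℝ} {A B : ℕ → Ω → ℝ} (ha : 0 < a) (hab : a < b)
    (hν : 0 < ν) (hκ : 0 < κ) (hA : IsMittagLefflerSequence P a ν A)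
    (hB : IsMittagLefflerSequence P b κ B) :
    ∀ᵐ ω ∂P, ∀ (M : ℕ) (r : ℝ), ∃ t, r ≤ t ∧
      count (fun i => A i ω) t + M ≤ count (fun i => B i ω) t := by
  obtain ⟨β, haβ, hβb⟩ := exists_between hab
  have hβ : 0 < β := ha.trans haβ
  have hb : 0 < b := ha.trans hab
  let τ : ℕ → ℝ := fun n => (n : ℝ) ^ (1 / β)
  have hτ : Tendsto τ atTop atTop :=
    (tendsto_rpow_atTop (by positivity)).comp tendsto_natCast_atTop_atTop
  -- The index `n + 1` for `A` is what makes its count at most `n`.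
  have hev : ∀ᵐ ω ∂P, ∀ M N : ℕ, ∃ n, N ≤ n ∧ τ n < ∑ i ∈ Finset.range (n + 1), A i ω ∧
      ∑ i ∈ Finset.range (n + M), B i ω ≤ τ n := by
    refine ae_all_iff.2 fun M => ae_all_iff.2 fun N => ?_
    rw [ae_iff, ← measureReal_eq_zero_iff]
    have hlimA : Tendsto (fun n : ℕ =>
        Real.exp 1 * (1 + ((n + 1 : ℕ) : ℝ) * ((ν * τ n) ^ a)⁻¹)⁻¹) atTop (𝓝 0) := by
      rw [← mul_zero (Real.exp 1)]
      exact (tendsto_inv_atTop_zero.comp (tendsto_atTop_add_const_left _ _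
        (tendsto_succ_mul_inv_rpow_atTop hν hβ haβ))).const_mul _
    have hlimB := (tendsto_add_mul_inv_rpow_zero hκ hβ hβb M).const_mul (1 - Real.exp (-1))⁻¹
    have hlim := hlimA.add hlimB
    rw [mul_zero, add_zero] at hlim
    refine le_antisymm (ge_of_tendsto hlim ?_) measureReal_nonneg
    filter_upwards [eventually_ge_atTop N, hτ.eventually_gt_atTop 0] with n hn hτn
    refine le_trans ?_ (add_le_add (hA.prob_sum_le ha hν (n + 1) hτn)
      (hB.prob_lt_sum hb hκ (n + M) hτn))
    -- Failure at every index from `N` on entails failure at this `n`, hence one of the two unlikely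
    -- events.
    refine (measureReal_mono fun ω hω => ?_).trans (measureReal_union_le _ _)
    simp only [mem_ofPred_eq, not_exists, not_and, not_le, mem_union] at hω ⊢
    by_contra! hcon
    exact absurd (hω n hn hcon.1) (not_lt.2 hcon.2)
  filter_upwards [hev, hA.ae_pos ha, hB.ae_pos hb, hB.ae_exists_lt_sum hb hκ]
    with ω hω hApos hBpos hBsum M r
  obtain ⟨N, hN⟩ := eventually_atTop.1 (hτ.eventually_ge_atTop r)
  obtain ⟨n, hNn, h1, h2⟩ := hω M N
  refine ⟨τ n, hN n hNn, ?_⟩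
  have h3 := count_le (fun i => (hApos i).le) h1
  have h4 := le_count (fun i => (hBpos i).le) hBsum h2
  omega

end MLQueue

theorem mainTheorem5 {Ω : Type*} [MeasurableSpace Ω] (P : Measure Ω) [IsProbabilityMeasure P]
    (α₁ α₂ lam mu : ℝ) (hα₁ : α₁ ∈ Ioo (0 : ℝ) 1) (hα₂ : α₂ ∈ Ioo (0 : ℝ) 1)
    (hlam : 0 < lam) (hmu : 0 < mu) (X Y : ℕ → Ω → ℝ)
    (hX : MLQueue.IsMittagLefflerSequence P α₁ lam X)
    (hY : MLQueue.IsMittagLefflerSequence P α₂ mu Y)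
    (hXY : IndepFun (fun ω i => X i ω) (fun ω i => Y i ω) P) :
    (α₁ < α₂ → ∀ᵐ ω ∂P, ∃ᶠ t : ℝ in atTop,
      MLQueue.queueLength (fun i => X i ω) (fun i => Y i ω) t = 0) ∧
    (α₂ < α₁ → ∀ᵐ ω ∂P, limsup (fun t : ℝ =>
      ((MLQueue.queueLength (fun i => X i ω) (fun i => Y i ω) t : ℝ) : EReal)) atTop = ⊤) := by
  refine ⟨fun hlt => ?_, fun hlt => ?_⟩
  · filter_upwards [hY.ae_pos hα₂.1, hY.ae_exists_lt_sum hα₂.1 hmu,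
      MLQueue.ae_exists_count_add_le hα₁.1 hlt hlam hmu hX hY] with ω h1 h2 h3
    exact MLQueue.frequently_queueLength_eq_zero (fun i => (h1 i).le) h2 fun M => h3 M 0
  · filter_upwards [hY.ae_pos hα₂.1, hY.ae_exists_lt_sum hα₂.1 hmu,
      MLQueue.ae_exists_count_add_le hα₂.1 hlt hmu hlam hY hX] with ω h1 h2 h3
    exact MLQueue.limsup_queueLength_eq_top (fun i => (h1 i).le) h2 h3
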